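/- A prefix-free machine is a partial computable function $U(p,y)$ of two binary strings, with binary string values, such that for every $y$, if $U(p,y)$ halts then $U(q,y)$ does not halt for any proper prefix $q$ of $p$. Put $K_U(x|y)=\min\{|p| : U(p,y)=x\}$ (with $K_U(x|y)=\infty$ if there is no such $p$). Fix a prefix-free machine $U$ that is optimal, i.e. for every prefix-free machine $V$ there is a constant $d$ with $K_U(x|y)\le K_V(x|y)+d$ for all strings $x,y$. Let $K(x)=K_U(x|\varepsilon)$, where $\varepsilon$ is the empty string, and for a natural number $n$ let $K(n)$ be the complexity $K$ of the binary expansion of $n$. Let $\log$ be the logarithm to base $2$, $\log^{(2)}=\log\log$ and $\log^{(3)}=\log\log\log$. Theorem. Let $Q$ be a set of binary strings whose complement is recursively enumerable, and suppose that for every $n\ge 0$ the set $Q$ contains at least one string of length $n$. Then there is a constant $c$ (depending on $U$ and $Q$ only) such that infinitely many $x\in Q$ satisfy $$K(x) < |x| + K(|x|) - \log^{(2)}|x| + c\,\log^{(3)}|x| .$$ -/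

import Mathlib

/-- A prefix-free machine `U (program, condition)`: a partial computable function such that, for
every condition `y`, no proper prefix of a halting program is halting. -/
structure IsPrefixMachine (U : List Bool → List Bool →. List Bool) : Prop where
  partrec : Partrec₂ U
  prefixFree : ∀ y p q : List Bool, (U p y).Dom → (U q y).Dom → q <+: p → q = p

/-- `K_U(x|y)`, the least length of a program `p` with `U(p, y) = x`
(`⊤` if there is no such program). -/
noncomputable def condK (U : List Bool → List Bool →. List Bool) (x y : List Bool) : ℕ∞ :=
  ⨅ p ∈ {p : List Bool | x ∈ U p y}, (p.length : ℕ∞)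

/-- An optimal prefix-free machine: its complexity function is minimal, up to an additive
constant, among those of all prefix-free machines. -/
structure IsOptimalPrefixMachine (U : List Bool → List Bool →. List Bool) : Prop where
  isPrefixMachine : IsPrefixMachine U
  optimal : ∀ V : List Bool → List Bool →. List Bool, IsPrefixMachine V →
    ∃ c : ℕ, ∀ x y : List Bool, condK U x y ≤ condK V x y + c

/-- Complexity with respect to an optimal machine is always finite. -/
theorem IsOptimalPrefixMachine.condK_ne_top {U : List Bool → List Bool →. List Bool}
    (hU : IsOptimalPrefixMachine U) (x y : List Bool) : condK U x y ≠ ⊤ := by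
  let V : List Bool → List Bool →. List Bool := fun p _ => if p = [] then Part.some x else Part.none
  have hV : IsPrefixMachine V := by
    refine ⟨?_, ?_⟩
    · have h : Computable fun a : List Bool × List Bool => if a.1 = [] then some x else none :=
        (Primrec.ite (PrimrecRel.comp Primrec.eq Primrec.fst (Primrec.const []))
          (Primrec.const (some x)) (Primrec.const none)).to_comp
      refine h.ofOption.of_eq fun a => ?_
      by_cases ha : a.1 = [] <;> simp [V, ha]
    · intro y p q hp hq _
      have key : ∀ r : List Bool, (V r y).Dom → r = [] := by
        intro r hr
        by_contra hne
        simp [V, hne] at hr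
      rw [key p hp, key q hq]
  obtain ⟨c, hc⟩ := hU.optimal V hV
  have h0 : condK V x y ≤ 0 := by
    refine (iInf₂_le ([] : List Bool) ?_).trans (by simp)
    simp [V]
  intro htop
  have h1 : (⊤ : ℕ∞) ≤ 0 + c := by
    rw [← htop]
    exact (hc x y).trans (add_le_add_left h0 _)
  simp at h1

/-- The prefix-free complexity `K(x)` of a string: the condition is the empty string. Its values
are natural numbers when `U` is optimal, since the complexity is then finite. -/
noncomputable def prefixK (U : List Bool → List Bool →. List Bool) (x : List Bool) : ℕ :=
  (condK U x []).toNat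

/-- The prefix-free complexity `K(n)` of a natural number, given by its binary expansion. -/
noncomputable def natPrefixK (U : List Bool → List Bool →. List Bool) (n : ℕ) : ℕ :=
  prefixK U (Nat.bits n)

/-- A set of strings is co-enumerable if its complement is recursively enumerable. -/
def IsCoEnumerable (Q : Set (List Bool)) : Prop :=
  REPred fun x : List Bool => x ∉ Q

/-- `log2Iter k t` is the `k`-fold iterated binary logarithm of `t`. -/
noncomputable def log2Iter (k : ℕ) (t : ℝ) : ℝ :=
  (Real.logb 2)^[k] t

/-! Enumerate the complement of `Q` in stages. Let `L = log n`, let `g = logGain L`, about `log L -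
4 log log L`, and let `ℓ n = n - g`. Given a shortest program `p` of `n` and `ℓ n` bits that hold,
modulo `2 ^ ℓ n`, the final number of enumerated strings of length `n`, search for a stage by which
`p` has halted and the count has this residue, and output a string not yet enumerated. If the output
lies in `Q`, its complexity is at most `K(n) + n - g + O(1)`. Otherwise the output is enumerated
later, so the count still has to grow by a positive multiple of `2 ^ ℓ n`
(`exists_simple_or_enumCount`).

Suppose the second case holds for all `n` with `log n = L`. Once `2 ^ m i` such numbers have count
at least `i * 2 ^ ℓ n` and no program of length at most `k i` so far, the stage can be found from
`L` and `i`, so these numbers have complexity at most `k i` (`exists_prefixK_le_of_large`). Their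
shortest programs thus halt only later, and each count passes `(i + 1) * 2 ^ ℓ n`. Few of them can
have programs of length at most `k (i + 1)`, so the argument repeats (`exists_stage_candidates`). A
level costs about `(log L) ^ 2` out of `L`, so `2 ^ g` levels fit (`two_pow_logGain_mul_le`). Then
all `2 ^ n` strings of some length `n` are enumerated, which is impossible. -/

/-! ### Evaluation in stages and unbounded search -/

/-- `e` is a primitive recursive evaluation in stages of the partial function `f`. -/
structure IsStageEval {α β : Type*} [Primcodable α] [Primcodable β] (f : α →. β)
    (e : ℕ → α → Option β) : Prop where
  primrec : Primrec₂ e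
  zero : ∀ a, e 0 a = none
  mono : ∀ {s t : ℕ} {a : α} {b : β}, s ≤ t → e s a = some b → e t a = some b
  mem_iff : ∀ {a : α} {b : β}, b ∈ f a ↔ ∃ t, e t a = some b

theorem exists_isStageEval {α β : Type*} [Primcodable α] [Primcodable β] {f : α →. β}
    (hf : Partrec f) : ∃ e, IsStageEval f e := by
  obtain ⟨c, hc⟩ := Nat.Partrec.Code.exists_code.1 hf
  have hmem : ∀ (a : α) (m : ℕ), m ∈ c.eval (Encodable.encode a) ↔
      ∃ b ∈ f a, Encodable.encode b = m := by
    intro a m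
    rw [hc]
    simp
  refine ⟨fun t a => (Nat.Partrec.Code.evaln t c (Encodable.encode a)).bind Encodable.decode,
    ?_, ?_, ?_, ?_⟩
  · refine Primrec.option_bind (Nat.Partrec.Code.primrec_evaln.comp
      (Primrec.pair (Primrec.pair Primrec.fst (Primrec.const c))
        (Primrec.encode.comp Primrec.snd))) ?_
    exact Primrec.decode.comp Primrec.snd
  · intro a
    simp [Nat.Partrec.Code.evaln]
  · intro s t a b hst h
    obtain ⟨m, hm, hb⟩ := Option.bind_eq_some_iff.1 h
    exact Option.bind_eq_some_iff.2 ⟨m, Nat.Partrec.Code.evaln_mono hst hm, hb⟩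
  · intro a b
    constructor
    · intro h
      obtain ⟨t, ht⟩ := Nat.Partrec.Code.evaln_complete.1
        ((hmem a (Encodable.encode b)).2 ⟨b, h, rfl⟩)
      exact ⟨t, Option.bind_eq_some_iff.2 ⟨_, ht, Encodable.encodek b⟩⟩
    · rintro ⟨t, h⟩
      obtain ⟨m, hm, hb⟩ := Option.bind_eq_some_iff.1 h
      obtain ⟨b', hb', rfl⟩ := (hmem a m).1 (Nat.Partrec.Code.evaln_sound hm)
      rw [Encodable.encodek] at hb
      cases hb
      exact hb'

/-- Unbounded search for a witness of a primitive recursive relation. -/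
theorem exists_partrec_search {α γ : Type*} [Primcodable α] [Primcodable γ] {R : α → γ → Prop}
    (hR : PrimrecRel R) : ∃ f : α →. γ, Partrec f ∧ (∀ a c, c ∈ f a → R a c) ∧
      ∀ a c, R a c → (f a).Dom := by
  classical
  let g : α → ℕ → Option γ := fun a e =>
    (Encodable.decode (α := γ) e).bind fun c => if R a c then some c else none
  have hg : Primrec₂ g := by
    refine Primrec.option_bind (Primrec.decode.comp Primrec.snd) ?_
    exact Primrec.ite (hR.comp (Primrec.fst.comp Primrec.fst) Primrec.snd)
      (Primrec.option_some.comp Primrec.snd) (Primrec.const none)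
  refine ⟨fun a => Nat.rfindOpt (g a), Partrec.rfindOpt hg.to_comp, ?_, ?_⟩
  · intro a c h
    obtain ⟨e, he⟩ := Nat.rfindOpt_spec h
    obtain ⟨c', -, hc⟩ := Option.bind_eq_some_iff.1 he
    split_ifs at hc with hR'
    cases hc
    exact hR'
  · intro a c h
    refine Nat.rfindOpt_dom.2 ⟨Encodable.encode c, c, ?_⟩
    simp [g, h]

/-! ### Upper bounds for complexity from explicit prefix-free machines -/

theorem prefixK_le {U : List Bool → List Bool →. List Bool} {x p : List Bool}
    (h : x ∈ U p []) : prefixK U x ≤ p.length :=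
  ENat.toNat_le_of_le_natCast (iInf₂_le p h)

theorem IsOptimalPrefixMachine.exists_program {U : List Bool → List Bool →. List Bool}
    (hU : IsOptimalPrefixMachine U) (x : List Bool) :
    ∃ p : List Bool, x ∈ U p [] ∧ p.length = prefixK U x := by
  have hne : {p : List Bool | x ∈ U p []}.Nonempty := by
    by_contra h
    rw [Set.not_nonempty_iff_eq_empty] at h
    refine hU.condK_ne_top x [] ?_
    simp [condK, h]
  have hp := Function.argminOn_mem (List.length : List Bool → ℕ) _ hne
  refine ⟨_, hp, le_antisymm ?_ (prefixK_le hp)⟩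
  have h1 : ((Function.argminOn List.length _ hne).length : ℕ∞) ≤ condK U x [] :=
    le_iInf₂ fun q hq => by exact_mod_cast Function.argminOn_le List.length _ hq
  rw [← ENat.natCast_toNat (hU.condK_ne_top x [])] at h1
  exact_mod_cast h1

theorem IsOptimalPrefixMachine.prefixK_le_of_machine {U V : List Bool → List Bool →. List Bool}
    (hU : IsOptimalPrefixMachine U) (hV : IsPrefixMachine V) :
    ∃ c : ℕ, ∀ p x : List Bool, x ∈ V p [] → prefixK U x ≤ p.length + c := by
  obtain ⟨c, hc⟩ := hU.optimal V hV
  refine ⟨c, fun p x h => ENat.toNat_le_of_le_natCast ((hc x []).trans ?_)⟩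
  push_cast
  exact add_le_add_left (iInf₂_le p h) _

theorem IsPrefixMachine.partrec_nil {U : List Bool → List Bool →. List Bool}
    (hU : IsPrefixMachine U) : Partrec fun p => U p [] :=
  hU.partrec.comp Computable.id (Computable.const [])

/-- The machine that reads a program of `U` for `z`, then `ℓ z` further bits `q`, and
processes both. -/
theorem IsPrefixMachine.exists_extension {U : List Bool → List Bool →. List Bool}
    (hU : IsPrefixMachine U) {ℓ : List Bool → ℕ} (hℓ : Primrec ℓ)
    {G : List Bool × List Bool × List Bool →. List Bool} (hG : Partrec G) :
    ∃ V, IsPrefixMachine V ∧ ∀ p z q x, z ∈ U p [] → q.length = ℓ z → x ∈ G (p, z, q) →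
      x ∈ V (p ++ q) [] := by
  obtain ⟨e, he⟩ := exists_isStageEval hU.partrec_nil
  let R : List Bool → (List Bool × List Bool × List Bool) × ℕ → Prop := fun w c =>
    (w = c.1.1 ++ c.1.2.2 ∧ e c.2 c.1.1 = some c.1.2.1) ∧ c.1.2.2.length = ℓ c.1.2.1
  have hp : Primrec fun x : List Bool × (List Bool × List Bool × List Bool) × ℕ => x.2.1.1 :=
    Primrec.fst.comp (Primrec.fst.comp Primrec.snd)
  have hz : Primrec fun x : List Bool × (List Bool × List Bool × List Bool) × ℕ => x.2.1.2.1 :=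
    Primrec.fst.comp (Primrec.snd.comp (Primrec.fst.comp Primrec.snd))
  have hq : Primrec fun x : List Bool × (List Bool × List Bool × List Bool) × ℕ => x.2.1.2.2 :=
    Primrec.snd.comp (Primrec.snd.comp (Primrec.fst.comp Primrec.snd))
  have hR : PrimrecRel R :=
    ((Primrec.eq.comp Primrec.fst (Primrec.list_append.comp hp hq)).and
      (Primrec.eq.comp (he.primrec.comp (Primrec.snd.comp Primrec.snd) hp)
        (Primrec.option_some.comp hz))).and
      (Primrec.eq.comp (Primrec.list_length.comp hq) (hℓ.comp hz))
  obtain ⟨f, hf, hfR, hfd⟩ := exists_partrec_search hR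
  have hspec : ∀ w c, c ∈ f w → w = c.1.1 ++ c.1.2.2 ∧ c.1.2.1 ∈ U c.1.1 [] ∧
      c.1.2.2.length = ℓ c.1.2.1 := by
    intro w c hc
    obtain ⟨⟨h1, h2⟩, h3⟩ := hfR w c hc
    exact ⟨h1, he.mem_iff.2 ⟨_, h2⟩, h3⟩
  -- Prefix-freeness of `U` forces `p = p'`, hence `z = z'`; then `q` and `q'` both have length `ℓ
  -- z`. This gives unique parsing as well as prefix-freeness of the new machine.
  have huniq : ∀ p q z p' q' z' : List Bool, z ∈ U p [] → z' ∈ U p' [] → q.length = ℓ z →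
      q'.length = ℓ z' → p ++ q <+: p' ++ q' → p = p' ∧ q = q' ∧ z = z' := by
    intro p q z p' q' z' hzp hzp' hq hq' hpre
    have h1 : p <+: p' ++ q' := (List.prefix_append p q).trans hpre
    have hpp : p = p' := by
      rcases List.prefix_or_prefix_of_prefix h1 (List.prefix_append p' q') with h | h
      · exact hU.prefixFree [] p' p (Part.dom_iff_mem.2 ⟨_, hzp'⟩) (Part.dom_iff_mem.2 ⟨_, hzp⟩) h
      · exact (hU.prefixFree [] p p' (Part.dom_iff_mem.2 ⟨_, hzp⟩)
          (Part.dom_iff_mem.2 ⟨_, hzp'⟩) h).symm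
    subst hpp
    have hzz : z = z' := Part.mem_unique hzp hzp'
    subst hzz
    refine ⟨rfl, ?_, rfl⟩
    rw [List.prefix_append_right_inj] at hpre
    exact hpre.eq_of_length (hq.trans hq'.symm)
  refine ⟨fun w _ => (f w).bind fun c => G c.1, ⟨?_, ?_⟩, ?_⟩
  · exact (hf.bind (hG.comp (Computable.fst.comp Computable.snd)).to₂).comp Computable.fst
  · intro _ w w' hw hw' hpre
    obtain ⟨c, hc⟩ := Part.dom_iff_mem.1 (Part.Dom.of_bind hw)
    obtain ⟨c', hc'⟩ := Part.dom_iff_mem.1 (Part.Dom.of_bind hw')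
    obtain ⟨rfl, h2, h3⟩ := hspec w c hc
    obtain ⟨rfl, h2', h3'⟩ := hspec w' c' hc'
    obtain ⟨h4, h5, -⟩ := huniq _ _ _ _ _ _ h2' h2 h3' h3 hpre
    rw [h4, h5]
  · intro p z q x hzp hql hx
    obtain ⟨t, ht⟩ := he.mem_iff.1 hzp
    obtain ⟨c, hc⟩ := Part.dom_iff_mem.1 (hfd (p ++ q) ((p, z, q), t) ⟨⟨rfl, ht⟩, hql⟩)
    obtain ⟨h1, h2, h3⟩ := hspec _ c hc
    obtain ⟨h4, h5, h6⟩ := huniq _ _ _ _ _ _ hzp h2 hql h3 (by rw [h1])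
    refine Part.mem_bind_iff.2 ⟨c, hc, ?_⟩
    have : c.1 = (p, z, q) := by rw [h4, h5, h6]
    rwa [this]

theorem IsOptimalPrefixMachine.prefixK_extension_le {U : List Bool → List Bool →. List Bool}
    (hU : IsOptimalPrefixMachine U) {ℓ : List Bool → ℕ} (hℓ : Primrec ℓ)
    {G : List Bool × List Bool × List Bool →. List Bool} (hG : Partrec G) :
    ∃ c : ℕ, ∀ p z q x, z ∈ U p [] → q.length = ℓ z → x ∈ G (p, z, q) →
      prefixK U x ≤ p.length + q.length + c := by
  obtain ⟨V, hV, hVs⟩ := hU.isPrefixMachine.exists_extension hℓ hG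
  obtain ⟨c, hc⟩ := hU.prefixK_le_of_machine hV
  refine ⟨c, fun p z q x h1 h2 h3 => ?_⟩
  simpa using hc _ _ (hVs p z q x h1 h2 h3)

/-- The self-delimiting code `1ˢ0x` of a string `x` of length `s`. -/
def selfDelimit (x : List Bool) : List Bool :=
  x.map (fun _ => true) ++ false :: x

/-- The block of `true`s ended by the first `false` fixes the length of the payload, so comparable
codes have payloads of equal length. -/
theorem eq_of_selfDelimit_prefix : ∀ {x y : List Bool},
    selfDelimit x <+: selfDelimit y → x = y := by
  have key : ∀ x y a b : List Bool, x.map (fun _ => true) ++ false :: a <+: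
      y.map (fun _ => true) ++ false :: b → x.length = y.length ∧ a <+: b := by
    intro x
    induction x with
    | nil =>
      intro y a b h
      cases y <;> simp_all
    | cons c x ih =>
      intro y a b h
      cases y with
      | nil => simp at h
      | cons d y =>
        simp only [List.map_cons, List.cons_append, List.cons_prefix_cons, true_and] at h
        simpa using ih y a b h
  intro x y h
  obtain ⟨h1, h2⟩ := key x y x y h
  exact h2.eq_of_length h1

theorem IsOptimalPrefixMachine.prefixK_le_two_mul_length
    {U : List Bool → List Bool →. List Bool} (hU : IsOptimalPrefixMachine U) :
    ∃ c : ℕ, ∀ x : List Bool, prefixK U x ≤ 2 * x.length + c := by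
  have hsd : Primrec selfDelimit :=
    Primrec.list_append.comp (Primrec.list_map Primrec.id (Primrec.const true).to₂)
      (Primrec.list_cons.comp (Primrec.const false) Primrec.id)
  have hR : PrimrecRel fun w x : List Bool => w = selfDelimit x :=
    Primrec.eq.comp Primrec.fst (hsd.comp Primrec.snd)
  obtain ⟨f, hf, hfR, hfd⟩ := exists_partrec_search hR
  have hV : IsPrefixMachine fun w _ => f w := by
    refine ⟨hf.comp Computable.fst, ?_⟩
    intro _ w w' hw hw' hpre
    obtain ⟨c, hc⟩ := Part.dom_iff_mem.1 hw
    obtain ⟨c', hc'⟩ := Part.dom_iff_mem.1 hw'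
    have h1 := hfR _ _ hc
    have h2 := hfR _ _ hc'
    subst h1 h2
    rw [eq_of_selfDelimit_prefix hpre]
  obtain ⟨c, hc⟩ := hU.prefixK_le_of_machine hV
  refine ⟨c + 1, fun x => ?_⟩
  obtain ⟨y, hy⟩ := Part.dom_iff_mem.1 (hfd (selfDelimit x) x rfl)
  have hxy : x = y := eq_of_selfDelimit_prefix (by rw [← hfR _ _ hy])
  subst hxy
  have := hc _ _ hy
  simp only [selfDelimit, List.length_append, List.length_map, List.length_cons] at this
  omega

/-! ### Primitive recursive arithmetic, strings and binary expansions -/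

theorem primrec_two_pow : Primrec fun n : ℕ => 2 ^ n :=
  (Primrec.nat_rec₁ 1 (Primrec.nat_mul.comp (Primrec.const 2) Primrec.snd).to₂).of_eq fun n => by
    induction n with
    | zero => rfl
    | succ n ih => rw [pow_succ', ← ih]

theorem primrec_log_two : Primrec (Nat.log 2) := by
  have h : PrimrecRel fun n i : ℕ => 2 ^ i ≤ n :=
    Primrec.nat_le.comp (primrec_two_pow.comp Primrec.snd) Primrec.fst
  refine (Primrec.nat_findGreatest Primrec.id h).of_eq fun n => ?_
  rcases Nat.eq_zero_or_pos n with rfl | hn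
  · simp
  · refine le_antisymm ?_ ?_
    · refine Nat.le_log_of_pow_le one_lt_two ?_
      exact Nat.findGreatest_spec (P := fun i => 2 ^ i ≤ n) (m := 0) (Nat.zero_le _)
        (by simpa using Nat.succ_le_of_lt hn)
    · exact Nat.le_findGreatest (Nat.log_le_self 2 n) (Nat.pow_log_le_self 2 hn.ne')

/-- All binary strings of a given length. -/
def strings : ℕ → List (List Bool)
  | 0 => [[]]
  | n + 1 => (strings n).map (List.cons true) ++ (strings n).map (List.cons false)

@[simp]
theorem mem_strings {n : ℕ} {x : List Bool} : x ∈ strings n ↔ x.length = n := by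
  induction n generalizing x with
  | zero => simp [strings]
  | succ n ih =>
    cases x with
    | nil => simp [strings]
    | cons b x => cases b <;> simp [strings, ih]

theorem nodup_strings (n : ℕ) : (strings n).Nodup := by
  induction n with
  | zero => simp [strings]
  | succ n ih =>
    refine List.Nodup.append (ih.map (List.cons_injective)) (ih.map (List.cons_injective)) ?_
    intro x hx hx'
    obtain ⟨y, -, rfl⟩ := List.mem_map.1 hx
    obtain ⟨z, -, hz⟩ := List.mem_map.1 hx'
    simp at hz

@[simp]
theorem length_strings (n : ℕ) : (strings n).length = 2 ^ n := by
  induction n with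
  | zero => simp [strings]
  | succ n ih => simp [strings, ih]; ring

theorem primrec_strings : Primrec strings := by
  have hc : ∀ b : Bool, Primrec₂ fun (_ : ℕ) (p : ℕ × List (List Bool)) =>
      p.2.map (List.cons b) := fun b =>
    Primrec.list_map (Primrec.snd.comp Primrec.snd)
      (Primrec.list_cons.comp (Primrec.const b) Primrec.snd).to₂
  refine (Primrec.nat_rec' Primrec.id (Primrec.const [[]])
    (Primrec.list_append.comp₂ (hc true) (hc false))).of_eq fun n => ?_
  induction n with
  | zero => rfl
  | succ n ih => simp only [strings, ← ih]; rfl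

/-- All binary strings of length at most a given number. -/
def stringsLE (n : ℕ) : List (List Bool) :=
  (List.range (n + 1)).flatMap strings

@[simp]
theorem mem_stringsLE {n : ℕ} {x : List Bool} : x ∈ stringsLE n ↔ x.length ≤ n := by
  simp [stringsLE]

theorem length_stringsLE_lt (n : ℕ) : (stringsLE n).length < 2 ^ (n + 1) := by
  have : ∀ m : ℕ, ((List.range m).flatMap strings).length < 2 ^ m := by
    intro m
    induction m with
    | zero => simp
    | succ m ih =>
      simp only [List.range_succ, List.flatMap_append, List.length_append, List.flatMap_cons,
        List.flatMap_nil, List.append_nil, length_strings]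
      rw [pow_succ]
      omega
  exact this (n + 1)

theorem primrec_stringsLE : Primrec stringsLE :=
  Primrec.list_flatMap (Primrec.list_range.comp Primrec.succ) (primrec_strings.comp Primrec.snd).to₂

/-- The number whose binary expansion, least significant bit first, is the given string. -/
def binaryValue (x : List Bool) : ℕ :=
  x.foldr (fun b n => b.toNat + 2 * n) 0

theorem primrec_binaryValue : Primrec binaryValue := by
  refine Primrec.list_foldr (g := fun _ => 0)
    (h := fun (_ : List Bool) (p : Bool × ℕ) => p.1.toNat + 2 * p.2)
    Primrec.id (Primrec.const 0) ?_
  refine (Primrec.nat_add.comp ((Primrec.dom_finite Bool.toNat).comp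
    (Primrec.fst.comp Primrec.snd)) (Primrec.nat_mul.comp (Primrec.const 2)
      (Primrec.snd.comp Primrec.snd))).to₂

@[simp]
theorem binaryValue_nil : binaryValue [] = 0 := rfl

@[simp]
theorem binaryValue_cons (b : Bool) (x : List Bool) :
    binaryValue (b :: x) = b.toNat + 2 * binaryValue x := rfl

@[simp]
theorem binaryValue_bits (n : ℕ) : binaryValue (Nat.bits n) = n := by
  induction n using Nat.binaryRec' with
  | zero => simp
  | bit b n h ih =>
    rw [Nat.bits_append_bit n b h, binaryValue_cons, ih, Nat.bit_val]
    ring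

/-- The last entry is the most significant digit; ending in `true` rules out leading zeros. Thus the
strings `u ++ [true]` with `u.length = L` are the expansions of the numbers `n` with `Nat.log 2 n =
L`. -/
theorem bits_binaryValue (x : List Bool) :
    Nat.bits (binaryValue (x ++ [true])) = x ++ [true] := by
  induction x with
  | nil => simp
  | cons b x ih =>
    have h0 : binaryValue (x ++ [true]) ≠ 0 := fun h => by
      rw [h] at ih
      simp at ih
    rw [List.cons_append, binaryValue_cons, add_comm, ← Nat.bit_val,
      Nat.bits_append_bit _ _ (fun h => absurd h h0), ih]

theorem exists_binaryValue_eq {m r : ℕ} (h : r < 2 ^ m) :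
    ∃ q : List Bool, q.length = m ∧ binaryValue q = r := by
  induction m generalizing r with
  | zero => exact ⟨[], rfl, by rw [binaryValue_nil]; omega⟩
  | succ m ih =>
    obtain ⟨q, h1, h2⟩ := ih (r := r / 2) (by rw [pow_succ] at h; omega)
    refine ⟨(r % 2 == 1) :: q, by simp [h1], ?_⟩
    rw [binaryValue_cons, h2]
    rcases Nat.mod_two_eq_zero_or_one r with h0 | h0 <;> simp [h0] <;> omega

theorem log_two_binaryValue (x : List Bool) :
    Nat.log 2 (binaryValue (x ++ [true])) = x.length := by
  have h : ∀ x : List Bool, 2 ^ x.length ≤ binaryValue (x ++ [true]) ∧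
      binaryValue (x ++ [true]) < 2 ^ (x.length + 1) := by
    intro x
    induction x with
    | nil => simp
    | cons b x ih =>
      rw [List.cons_append, binaryValue_cons, List.length_cons, pow_succ, pow_succ _ (_ + 1)]
      cases b <;> simp <;> omega
  exact Nat.log_eq_of_pow_le_of_lt_pow (h x).1 (h x).2

/-! ### Counting enumerated strings of a given length -/

/-- `r` is a primitive recursive enumeration in stages of the predicate `P`. -/
structure IsStageEnum {α : Type*} [Primcodable α] (P : α → Prop) (r : ℕ → α → Bool) : Prop where
  primrec : Primrec₂ r
  mono : ∀ {s t : ℕ} {a : α}, s ≤ t → r s a = true → r t a = true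
  iff : ∀ {a : α}, P a ↔ ∃ t, r t a = true

theorem exists_isStageEnum {α : Type*} [Primcodable α] {P : α → Prop} (hP : REPred P) :
    ∃ r, IsStageEnum P r := by
  obtain ⟨e, he⟩ := exists_isStageEval hP
  refine ⟨fun t a => (e t a).isSome, Primrec.option_isSome.comp he.primrec, ?_, ?_⟩
  · intro s t a hst h
    obtain ⟨b, hb⟩ := Option.isSome_iff_exists.1 h
    exact Option.isSome_iff_exists.2 ⟨b, he.mono hst hb⟩
  · intro a
    have h := he.mem_iff (a := a) (b := ())
    simp only [Part.mem_assert_iff, Part.mem_some_iff, exists_prop, and_true] at h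
    rw [h]
    exact exists_congr fun t => by
      rw [Option.isSome_iff_exists]
      exact ⟨fun h => ⟨_, h⟩, fun ⟨_, h⟩ => h⟩

/-- The number of strings of length `n` enumerated by stage `t`. -/
def enumCount (r : ℕ → List Bool → Bool) (t n : ℕ) : ℕ :=
  ((strings n).filter fun x => r t x = true).length

section

variable {P : List Bool → Prop} {r : ℕ → List Bool → Bool}

theorem IsStageEnum.primrec_enumCount (hr : IsStageEnum P r) : Primrec₂ (enumCount r) := by
  have h : PrimrecRel fun (x : List Bool) (t : ℕ) => r t x = true :=
    Primrec.eq.comp (hr.primrec.comp Primrec.snd Primrec.fst) (Primrec.const true)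
  exact Primrec.list_length.comp (h.listFilter.comp (primrec_strings.comp Primrec.snd) Primrec.fst)

theorem enumCount_mono (hr : IsStageEnum P r) {s t : ℕ} (h : s ≤ t) (n : ℕ) :
    enumCount r s n ≤ enumCount r t n :=
  (List.monotone_filter_right _ fun _ hx => by simpa using hr.mono h (by simpa using hx)).length_le

theorem enumCount_lt (hr : IsStageEnum P r) {s t n : ℕ} (h : s ≤ t) {x : List Bool}
    (hx : x.length = n) (hs : r s x = false) (ht : r t x = true) :
    enumCount r s n < enumCount r t n := by
  refine lt_of_le_of_ne (enumCount_mono hr h n) fun heq => ?_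
  have hsub : ((strings n).filter fun x => r s x = true).Sublist
      ((strings n).filter fun x => r t x = true) :=
    List.monotone_filter_right _ fun _ hx => by simpa using hr.mono h (by simpa using hx)
  have := hsub.eq_of_length heq
  have hmem : x ∈ (strings n).filter fun x => r t x = true := by simp [hx, ht]
  rw [← this] at hmem
  simp [hs] at hmem

theorem IsStageEnum.exists_stage (hr : IsStageEnum P r) (n : ℕ) :
    ∃ T, ∀ x : List Bool, x.length = n → P x → r T x = true := by
  have : ∀ l : List (List Bool), ∃ T, ∀ x ∈ l, P x → r T x = true := by
    intro l
    induction l with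
    | nil => simp
    | cons y l ih =>
      obtain ⟨T, hT⟩ := ih
      by_cases hy : P y
      · obtain ⟨s, hs⟩ := hr.iff.1 hy
        refine ⟨max s T, ?_⟩
        simp only [List.forall_mem_cons]
        exact ⟨fun _ => hr.mono (le_max_left _ _) hs,
          fun x hx hP => hr.mono (le_max_right _ _) (hT x hx hP)⟩
      · refine ⟨T, ?_⟩
        simp only [List.forall_mem_cons]
        exact ⟨fun h => absurd h hy, hT⟩
  obtain ⟨T, hT⟩ := this (strings n)
  exact ⟨T, fun x hx => hT x (by simpa using hx)⟩

theorem enumCount_lt_two_pow (hr : IsStageEnum P r) {n : ℕ} {x : List Bool} (hx : x.length = n)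
    (hP : ¬ P x) (t : ℕ) : enumCount r t n < 2 ^ n := by
  rw [← length_strings n]
  refine lt_of_le_of_ne (List.length_filter_le _ _) fun h => ?_
  have h1 := List.length_filter_eq_length_iff.1 h x (by simpa using hx)
  exact hP (hr.iff.2 ⟨t, by simpa using h1⟩)

end

/-! ### The dichotomy for a single length -/

/-- Either some string of length `n` that is never enumerated is simple given a shortest program
of `n`, or many strings are enumerated after the stage at which this program halts. -/
theorem IsOptimalPrefixMachine.exists_simple_or_enumCount
    {U : List Bool → List Bool →. List Bool} (hU : IsOptimalPrefixMachine U)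
    {Q : Set (List Bool)} {r : ℕ → List Bool → Bool} (hr : IsStageEnum (fun x => x ∉ Q) r)
    (hlen : ∀ n : ℕ, ∃ x ∈ Q, x.length = n)
    {e : ℕ → List Bool → Option (List Bool)} (he : IsStageEval (fun p => U p []) e)
    {ℓ : ℕ → ℕ} (hℓ : Primrec ℓ) :
    ∃ c : ℕ, ∀ n : ℕ,
      (∃ x ∈ Q, x.length = n ∧ prefixK U x ≤ natPrefixK U n + ℓ n + c) ∨
      ∃ p t T, p.length = natPrefixK U n ∧ e t p = some (Nat.bits n) ∧
        enumCount r t n + 2 ^ ℓ n ≤ enumCount r T n := by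
  let R : List Bool × List Bool × List Bool → ℕ × List Bool → Prop := fun a c =>
    (e c.1 a.1 = some a.2.1 ∧
      enumCount r c.1 (binaryValue a.2.1) % 2 ^ a.2.2.length = binaryValue a.2.2) ∧
    (c.2.length = binaryValue a.2.1 ∧ r c.1 c.2 = false)
  have hp : Primrec fun x : (List Bool × List Bool × List Bool) × ℕ × List Bool => x.1.1 :=
    Primrec.fst.comp Primrec.fst
  have hz : Primrec fun x : (List Bool × List Bool × List Bool) × ℕ × List Bool => x.1.2.1 :=
    Primrec.fst.comp (Primrec.snd.comp Primrec.fst)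
  have hq : Primrec fun x : (List Bool × List Bool × List Bool) × ℕ × List Bool => x.1.2.2 :=
    Primrec.snd.comp (Primrec.snd.comp Primrec.fst)
  have ht : Primrec fun x : (List Bool × List Bool × List Bool) × ℕ × List Bool => x.2.1 :=
    Primrec.fst.comp Primrec.snd
  have hx : Primrec fun x : (List Bool × List Bool × List Bool) × ℕ × List Bool => x.2.2 :=
    Primrec.snd.comp Primrec.snd
  have hR : PrimrecRel R :=
    ((Primrec.eq.comp (he.primrec.comp ht hp) (Primrec.option_some.comp hz)).and
      (Primrec.eq.comp (Primrec.nat_mod.comp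
        (hr.primrec_enumCount.comp ht (primrec_binaryValue.comp hz))
        (primrec_two_pow.comp (Primrec.list_length.comp hq))) (primrec_binaryValue.comp hq))).and
    ((Primrec.eq.comp (Primrec.list_length.comp hx) (primrec_binaryValue.comp hz)).and
      (Primrec.eq.comp (hr.primrec.comp ht hx) (Primrec.const false)))
  obtain ⟨f, hf, hfR, hfd⟩ := exists_partrec_search hR
  obtain ⟨c, hc⟩ := hU.prefixK_extension_le (ℓ := fun z => ℓ (binaryValue z))
    (hℓ.comp primrec_binaryValue) (hf.map (Computable.snd.comp Computable.snd).to₂)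
  refine ⟨c, fun n => ?_⟩
  obtain ⟨p, hpU, hpl⟩ := hU.exists_program (Nat.bits n)
  obtain ⟨T, hT⟩ := hr.exists_stage n
  obtain ⟨t₀, ht₀⟩ := he.mem_iff.1 hpU
  obtain ⟨y, hyQ, hyl⟩ := hlen n
  -- At stage `max t₀ T` the program has halted and every string of length `n` outside `Q` is
  -- enumerated. With this residue the search must stop, since that stage and `y ∈ Q` are a witness;
  -- it may stop at another stage.
  obtain ⟨q, hql, hqv⟩ := exists_binaryValue_eq
    (Nat.mod_lt (enumCount r (max t₀ T) n) (Nat.two_pow_pos (ℓ n)))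
  have hyr : ∀ t, r t y = false := fun t => by
    by_contra h
    exact hr.iff.2 ⟨t, by simpa using h⟩ hyQ
  obtain ⟨⟨t, x⟩, htx⟩ := Part.dom_iff_mem.1 (hfd (p, Nat.bits n, q) (max t₀ T, y)
    ⟨⟨he.mono (le_max_left _ _) ht₀, by simp [hql, hqv]⟩, by simpa using hyl, hyr _⟩)
  obtain ⟨⟨h1, h2⟩, h3, h4⟩ := hfR _ _ htx
  simp only [binaryValue_bits, hql, hqv] at h1 h2 h3 h4
  have hK := hc p (Nat.bits n) q x hpU (by simpa using hql)
    (Part.mem_map_iff _ |>.2 ⟨_, htx, rfl⟩)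
  by_cases hxQ : x ∈ Q
  · left
    refine ⟨x, hxQ, h3, ?_⟩
    rw [natPrefixK, ← hpl, ← hql]
    exact hK
  · right
    refine ⟨p, t, max t₀ T, hpl, h1, ?_⟩
    have hxT := hr.mono (le_max_right t₀ T) (hT x h3 hxQ)
    have hlt : t ≤ max t₀ T := by
      by_contra hlt
      have := hr.mono (not_le.1 hlt).le hxT
      simp [h4] at this
    have hcount := enumCount_lt hr hlt h3 h4 hxT
    -- The two counts are congruent modulo `2 ^ ℓ n` and differ, so they differ by at least `2 ^ ℓ
    -- n`.
    have hmod : enumCount r t n ≡ enumCount r (max t₀ T) n [MOD 2 ^ ℓ n] := h2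
    have hdvd := (Nat.modEq_iff_dvd' hcount.le).1 hmod
    have := Nat.le_of_dvd (Nat.sub_pos_of_lt hcount) hdvd
    omega

/-! ### Iterating over levels -/

/-- If some stage of a primitive recursive process yields a list of at least `2 ^ m a` strings,
then `2 ^ m a` strings in such a list have complexity close to `m a`. -/
theorem IsOptimalPrefixMachine.exists_prefixK_le_of_large
    {U : List Bool → List Bool →. List Bool} (hU : IsOptimalPrefixMachine U)
    {F : ℕ → ℕ → List (List Bool)} (hF : Primrec₂ F) {m : ℕ → ℕ} (hm : Primrec m) :
    ∃ c : ℕ, ∀ a : ℕ, (∃ t, 2 ^ m a ≤ (F t a).length) → ∃ t, 2 ^ m a ≤ (F t a).length ∧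
      ∀ y ∈ (F t a).take (2 ^ m a), prefixK U y ≤ 2 * Nat.size a + m a + c := by
  have hR : PrimrecRel fun a t : ℕ => 2 ^ m a ≤ (F t a).length :=
    Primrec.nat_le.comp (primrec_two_pow.comp (hm.comp Primrec.fst))
      (Primrec.list_length.comp (hF.comp Primrec.snd Primrec.fst))
  obtain ⟨f, hf, hfR, hfd⟩ := exists_partrec_search hR
  have hz : Primrec fun a : List Bool × List Bool × List Bool => binaryValue a.2.1 :=
    primrec_binaryValue.comp (Primrec.fst.comp Primrec.snd)
  have hG : Partrec fun a : List Bool × List Bool × List Bool =>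
      (f (binaryValue a.2.1)).map fun t => (F t (binaryValue a.2.1)).getD (binaryValue a.2.2) [] := by
    refine (hf.comp hz.to_comp).map (Primrec.to_comp ?_)
    exact (Primrec.list_getD []).comp (hF.comp Primrec.snd (hz.comp Primrec.fst))
      (primrec_binaryValue.comp (Primrec.snd.comp (Primrec.snd.comp Primrec.fst)))
  obtain ⟨c₁, hc₁⟩ := hU.prefixK_extension_le (ℓ := fun z => m (binaryValue z))
    (hm.comp primrec_binaryValue) hG
  obtain ⟨c₂, hc₂⟩ := hU.prefixK_le_two_mul_length
  refine ⟨c₁ + c₂, fun a ⟨t₀, ht₀⟩ => ?_⟩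
  -- The stage found depends on `a` alone, so one list serves all indices `q` of `m a` bits.
  obtain ⟨t, ht⟩ := Part.dom_iff_mem.1 (hfd a t₀ ht₀)
  refine ⟨t, hfR a t ht, fun y hy => ?_⟩
  obtain ⟨j, hj, rfl⟩ := List.getElem_of_mem hy
  rw [List.length_take] at hj
  obtain ⟨q, hql, hqv⟩ := exists_binaryValue_eq (lt_of_lt_of_le hj (min_le_left _ _))
  obtain ⟨p, hpU, hpl⟩ := hU.exists_program (Nat.bits a)
  have h1 := hc₁ p (Nat.bits a) q ((F t a).getD j []) hpU (by simpa using hql)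
    (Part.mem_map_iff _ |>.2 ⟨t, by simpa using ht, by simp [hqv]⟩)
  have h2 := hc₂ (Nat.bits a)
  rw [Nat.size_eq_bits_len, hql, hpl] at *
  rw [List.getElem_take]
  rw [List.getD_eq_getElem _ _ (lt_of_lt_of_le hj (min_le_right _ _))] at h1
  omega

/-- The expansions `y` of the numbers `n` with `Nat.log 2 n = L` such that by stage `t` at least
`i * 2 ^ ℓ n` strings of length `n` are enumerated, and no program of length at most `k` has
produced `y`. -/
def candidates (e : ℕ → List Bool → Option (List Bool)) (r : ℕ → List Bool → Bool) (ℓ : ℕ → ℕ)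
    (t L i k : ℕ) : List (List Bool) :=
  ((strings L).map fun u => u ++ [true]).filter fun y =>
    i * 2 ^ ℓ (binaryValue y) ≤ enumCount r t (binaryValue y) ∧
      ∀ p ∈ stringsLE k, e t p ≠ some y

section

variable {U : List Bool → List Bool →. List Bool} {P : List Bool → Prop}
  {e : ℕ → List Bool → Option (List Bool)} {r : ℕ → List Bool → Bool} {ℓ : ℕ → ℕ}

theorem primrec_candidates {f : List Bool →. List Bool} (he : IsStageEval f e)
    (hr : IsStageEnum P r) (hℓ : Primrec ℓ) {α : Type*} [Primcodable α] {t L i k : α → ℕ}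
    (ht : Primrec t) (hL : Primrec L) (hi : Primrec i) (hk : Primrec k) :
    Primrec fun a => candidates e r ℓ (t a) (L a) (i a) (k a) := by
  have hprog : PrimrecRel fun (p : List Bool) (b : List Bool × ℕ) => e b.2 p ≠ some b.1 :=
    (Primrec.eq.comp (he.primrec.comp (Primrec.snd.comp Primrec.snd) Primrec.fst)
      (Primrec.option_some.comp (Primrec.fst.comp Primrec.snd))).not
  have hn : Primrec fun a : List Bool × ℕ × ℕ × ℕ => binaryValue a.1 :=
    primrec_binaryValue.comp Primrec.fst
  have hrel : PrimrecRel fun (y : List Bool) (b : ℕ × ℕ × ℕ) =>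
      b.2.1 * 2 ^ ℓ (binaryValue y) ≤ enumCount r b.1 (binaryValue y) ∧
        ∀ p ∈ stringsLE b.2.2, e b.1 p ≠ some y := by
    refine (Primrec.nat_le.comp (Primrec.nat_mul.comp
      (Primrec.fst.comp (Primrec.snd.comp Primrec.snd)) (primrec_two_pow.comp (hℓ.comp hn)))
      (hr.primrec_enumCount.comp (Primrec.fst.comp Primrec.snd) hn)).and ?_
    exact hprog.forall_mem_list.comp
      (primrec_stringsLE.comp (Primrec.snd.comp (Primrec.snd.comp Primrec.snd)))
      (Primrec.pair Primrec.fst (Primrec.fst.comp Primrec.snd))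
  exact hrel.listFilter.comp (Primrec.list_map (primrec_strings.comp hL)
    (Primrec.list_append.comp Primrec.snd (Primrec.const [true])).to₂)
    (Primrec.pair ht (Primrec.pair hi hk))

theorem mem_candidates {t L i k : ℕ} {y : List Bool} : y ∈ candidates e r ℓ t L i k ↔
    (∃ u : List Bool, u.length = L ∧ u ++ [true] = y) ∧
      i * 2 ^ ℓ (binaryValue y) ≤ enumCount r t (binaryValue y) ∧
      ∀ p : List Bool, p.length ≤ k → e t p ≠ some y := by
  simp [candidates]

theorem nodup_candidates (t L i k : ℕ) : (candidates e r ℓ t L i k).Nodup :=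
  ((nodup_strings L).map fun _ _ h => List.append_cancel_right h).filter _

/-- Few strings are produced by programs of length at most `k`, so that most members of a long
list remain candidates. -/
theorem two_pow_le_length_candidates {T L i k : ℕ} {l : List (List Bool)} (hl : l.Nodup)
    (hlen : 2 ^ (k + 2) ≤ l.length)
    (h : ∀ y ∈ l, (∃ u : List Bool, u.length = L ∧ u ++ [true] = y) ∧
      i * 2 ^ ℓ (binaryValue y) ≤ enumCount r T (binaryValue y)) :
    2 ^ (k + 1) ≤ (candidates e r ℓ T L i k).length := by
  classical
  let S : List Bool → Bool := fun y => decide (∀ p ∈ stringsLE k, e T p ≠ some y)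
  have h1 : (l.filter S).length ≤ (candidates e r ℓ T L i k).length := by
    refine ((hl.filter _).subperm fun y hy => ?_).length_le
    rw [List.mem_filter] at hy
    refine mem_candidates.2 ⟨(h y hy.1).1, (h y hy.1).2, fun p hp => ?_⟩
    exact (of_decide_eq_true hy.2) p (by simpa using hp)
  have h2 : (l.filter fun y => !S y).length ≤ (stringsLE k).length := by
    -- Each rejected string is the output of some program in `stringsLE k`, and a program has at
    -- most one output.
    refine le_trans ((hl.filter _).subperm (l₂ := (stringsLE k).filterMap (e T))
      fun y hy => ?_).length_le (List.length_filterMap_le _ _)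
    rw [List.mem_filter] at hy
    simpa [S] using hy.2
  have h3 := length_stringsLE_lt k
  have h4 := List.length_eq_length_filter_add (l := l) S
  rw [pow_succ] at hlen
  omega

/-- As long as candidates get short programs, there are candidates for the next level. -/
theorem exists_stage_candidates (he : IsStageEval (fun p => U p []) e) (hr : IsStageEnum P r)
    {L I : ℕ} {k m : ℕ → ℕ}
    (hK : ∀ i < I, (∃ t, 2 ^ m i ≤ (candidates e r ℓ t L i (k i)).length) →
      ∃ t, 2 ^ m i ≤ (candidates e r ℓ t L i (k i)).length ∧
        ∀ y ∈ (candidates e r ℓ t L i (k i)).take (2 ^ m i), prefixK U y ≤ k i)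
    (hcount : ∀ u : List Bool, u.length = L → ∃ p t T, p.length = prefixK U (u ++ [true]) ∧
      e t p = some (u ++ [true]) ∧
      enumCount r t (binaryValue (u ++ [true])) + 2 ^ ℓ (binaryValue (u ++ [true])) ≤
        enumCount r T (binaryValue (u ++ [true])))
    (hm₀ : m 0 ≤ L) (hm : ∀ i < I, m i = k (i + 1) + 2 ∧ m (i + 1) ≤ k (i + 1)) :
    ∀ i ≤ I, ∃ t, 2 ^ m i ≤ (candidates e r ℓ t L i (k i)).length := by
  intro i
  induction i with
  | zero =>
    intro _
    refine ⟨0, ?_⟩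
    -- At stage 0 nothing has halted, and the count condition is void at level 0, so every expansion
    -- is a candidate.
    have : candidates e r ℓ 0 L 0 (k 0) = (strings L).map fun u => u ++ [true] := by
      simp [candidates, he.zero]
    rw [this, List.length_map, length_strings]
    exact Nat.pow_le_pow_right two_pos hm₀
  | succ i ih =>
    intro hi
    obtain ⟨t, ht, hy⟩ := hK i hi (ih (by omega))
    set l := (candidates e r ℓ t L i (k i)).take (2 ^ m i) with hl
    have hcand : ∀ y ∈ l, y ∈ candidates e r ℓ t L i (k i) := fun y hy => List.mem_of_mem_take hy
    have hstage : ∀ y ∈ l, ∃ T, (i + 1) * 2 ^ ℓ (binaryValue y) ≤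
        enumCount r T (binaryValue y) := by
      intro y hyl
      obtain ⟨⟨u, hu, rfl⟩, hcnt, hprog⟩ := mem_candidates.1 (hcand y hyl)
      obtain ⟨p, t', T, hpl, hpe, hT⟩ := hcount u hu
      refine ⟨T, ?_⟩
      -- A shortest program of `y` has length at most `k i` but has not produced `y` by stage `t`;
      -- it does so by `t'`, hence the increase by `2 ^ ℓ` comes on top of the count at `t`.
      have htt : t ≤ t' := by
        by_contra hlt
        refine hprog p ?_ (he.mono (not_le.1 hlt).le hpe)
        rw [hpl]
        exact hy _ hyl
      have := enumCount_mono hr htt (binaryValue (u ++ [true]))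
      rw [add_mul, one_mul]
      omega
    have hsup : ∃ T, ∀ y ∈ l, (i + 1) * 2 ^ ℓ (binaryValue y) ≤
        enumCount r T (binaryValue y) := by
      choose! T hT using hstage
      -- The sum serves as a common upper bound of the finitely many stages.
      refine ⟨(l.map T).sum, fun y hyl => (hT y hyl).trans (enumCount_mono hr ?_ _)⟩
      exact List.le_sum_of_mem (List.mem_map_of_mem hyl)
    obtain ⟨T, hT⟩ := hsup
    obtain ⟨h1, h2⟩ := hm i hi
    refine ⟨T, le_trans (Nat.pow_le_pow_right two_pos (h2.trans (Nat.le_succ _))) ?_⟩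
    refine two_pow_le_length_candidates (l := l)
      ((nodup_candidates t L i (k i)).sublist (List.take_sublist _ _)) ?_ fun y hyl =>
        ⟨(mem_candidates.1 (hcand y hyl)).1, hT y hyl⟩
    rw [hl, List.length_take, min_eq_left ht, h1]

end

/-! ### Choice of parameters -/

/-- The gain `log log n - 4 log log log n`, for `L = log n`. -/
def logGain (L : ℕ) : ℕ :=
  Nat.log 2 L - 4 * Nat.log 2 (Nat.log 2 L)

theorem primrec_logGain : Primrec logGain :=
  Primrec.nat_sub.comp primrec_log_two (Primrec.nat_mul.comp (Primrec.const 4)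
    (primrec_log_two.comp primrec_log_two))

/-- This is the budget for `2 ^ logGain L` levels. With `s = log L` and `u = log s`, one has `s * s
+ 2 ≤ 2 ^ (2 * u + 3)`, so the factor `2 ^ (-4 * u)` in the number of levels more than pays for the
cost of a level. The bound `4 ≤ u` also gives `4 * u ≤ s`, so the subtraction in `logGain` is not
truncated. -/
theorem two_pow_logGain_mul_le {L : ℕ} (h : 4 ≤ Nat.log 2 (Nat.log 2 L)) :
    2 ^ logGain L * (Nat.log 2 L * Nat.log 2 L + 2) + Nat.log 2 L * Nat.log 2 L ≤ L := by
  obtain ⟨s, hs⟩ : ∃ s, Nat.log 2 L = s := ⟨_, rfl⟩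
  obtain ⟨u, hu⟩ : ∃ u, Nat.log 2 s = u := ⟨_, rfl⟩
  have hL0 : L ≠ 0 := fun h0 => by simp [h0] at h
  have hs0 : s ≠ 0 := fun h0 => by simp [hs, h0] at h
  have hL : 2 ^ s ≤ L := hs ▸ Nat.pow_log_le_self 2 hL0
  have hus : 2 ^ u ≤ s := hu ▸ Nat.pow_log_le_self 2 hs0
  have hsu : s < 2 ^ (u + 1) := hu ▸ Nat.lt_pow_succ_log_self one_lt_two s
  simp only [logGain, hs, hu] at h ⊢
  have h4 : ∀ v : ℕ, 4 ≤ v → 4 * v ≤ 2 ^ v := by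
    intro v hv
    induction v, hv using Nat.le_induction with
    | base => norm_num
    | succ v hv ih => rw [pow_succ]; omega
  have hu4 : 4 * u ≤ s := (h4 u h).trans hus
  have hss : s * s + 2 ≤ 2 ^ (2 * u + 3) := by
    have h1 : s * s ≤ 2 ^ (u + 1) * 2 ^ (u + 1) := Nat.mul_le_mul hsu.le hsu.le
    have h2 : 2 ^ (2 * u + 3) = 2 * (2 ^ (u + 1) * 2 ^ (u + 1)) := by ring
    have h3 : 2 ≤ 2 ^ (u + 1) := by
      rw [pow_succ]
      have := Nat.one_le_two_pow (n := u)
      omega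
    have h5 := Nat.mul_le_mul h3 h3
    omega
  have hA : 2 ^ (s - 4 * u) * (s * s + 2) ≤ 2 ^ (s - 1) :=
    calc 2 ^ (s - 4 * u) * (s * s + 2) ≤ 2 ^ (s - 4 * u) * 2 ^ (2 * u + 3) :=
          Nat.mul_le_mul_left _ hss
      _ = 2 ^ (s - 4 * u + (2 * u + 3)) := (pow_add _ _ _).symm
      _ ≤ 2 ^ (s - 1) := Nat.pow_le_pow_right two_pos (by omega)
  have hB : s * s ≤ 2 ^ (s - 1) :=
    ((Nat.le_add_right _ 2).trans hss).trans (Nat.pow_le_pow_right two_pos (by omega))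
  have hC : 2 ^ s = 2 ^ (s - 1) * 2 := by
    rw [← pow_succ]
    congr 1
    omega
  omega

theorem size_pair_le {L i : ℕ} (h : i ≤ L) :
    Nat.size (Nat.pair L i) ≤ 2 * Nat.log 2 L + 2 := by
  rw [Nat.size_le]
  have h1 := Nat.pair_lt_max_add_one_sq L i
  rw [max_eq_left h] at h1
  have h2 : L + 1 ≤ 2 ^ (Nat.log 2 L + 1) := Nat.lt_pow_succ_log_self one_lt_two L
  calc Nat.pair L i < (L + 1) ^ 2 := h1
    _ ≤ (2 ^ (Nat.log 2 L + 1)) ^ 2 := Nat.pow_le_pow_left h2 2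
    _ = 2 ^ (2 * Nat.log 2 L + 2) := by ring

/-- For every large `L` there is a length `n` with `Nat.log 2 n = L` at which the set contains a
string that is simpler than typical strings of length `n`. -/
theorem IsOptimalPrefixMachine.exists_simple {U : List Bool → List Bool →. List Bool}
    (hU : IsOptimalPrefixMachine U) {Q : Set (List Bool)} (hQ : IsCoEnumerable Q)
    (hlen : ∀ n : ℕ, ∃ x ∈ Q, x.length = n) :
    ∃ c L₀ : ℕ, ∀ L, L₀ ≤ Nat.log 2 (Nat.log 2 L) → ∃ x ∈ Q, Nat.log 2 x.length = L ∧
      prefixK U x ≤ natPrefixK U x.length + (x.length - logGain L) + c := by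
  obtain ⟨r, hr⟩ := exists_isStageEnum hQ
  obtain ⟨e, he⟩ := exists_isStageEval hU.isPrefixMachine.partrec_nil
  set ℓ : ℕ → ℕ := fun n => n - logGain (Nat.log 2 n) with hℓdef
  have hℓ : Primrec ℓ :=
    Primrec.nat_sub.comp Primrec.id (primrec_logGain.comp primrec_log_two)
  -- The gap `(log L) ^ 2` between `k` and `m` absorbs the `O(log L)` bits describing `L` and `i`;
  -- the extra 2 pays for discarding numbers with short programs, so that `m i = k (i + 1) + 2`.
  set k : ℕ → ℕ → ℕ := fun L i => L - i * (Nat.log 2 L * Nat.log 2 L + 2) with hkdef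
  set m : ℕ → ℕ → ℕ := fun L i => k L i - Nat.log 2 L * Nat.log 2 L with hmdef
  have hfst : Primrec fun a : ℕ => a.unpair.1 := Primrec.fst.comp Primrec.unpair
  have hsnd : Primrec fun a : ℕ => a.unpair.2 := Primrec.snd.comp Primrec.unpair
  have hsq : Primrec fun a : ℕ => Nat.log 2 a.unpair.1 * Nat.log 2 a.unpair.1 :=
    Primrec.nat_mul.comp (primrec_log_two.comp hfst) (primrec_log_two.comp hfst)
  have hk : Primrec fun a : ℕ => k a.unpair.1 a.unpair.2 :=
    Primrec.nat_sub.comp hfst (Primrec.nat_mul.comp hsnd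
      (Primrec.nat_add.comp hsq (Primrec.const 2)))
  have hm : Primrec fun a : ℕ => m a.unpair.1 a.unpair.2 := Primrec.nat_sub.comp hk hsq
  have hF : Primrec₂ fun t a : ℕ =>
      candidates e r ℓ t a.unpair.1 a.unpair.2 (k a.unpair.1 a.unpair.2) :=
    primrec_candidates he hr hℓ Primrec.fst (hfst.comp Primrec.snd) (hsnd.comp Primrec.snd)
      (hk.comp Primrec.snd)
  obtain ⟨c₁, hc₁⟩ := hU.exists_prefixK_le_of_large hF hm
  obtain ⟨c, hc⟩ := hU.exists_simple_or_enumCount hr hlen he hℓ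
  refine ⟨c, c₁ + 8, fun L hL => ?_⟩
  by_contra! hno
  have hcount : ∀ n, Nat.log 2 n = L → ∃ p t T, p.length = natPrefixK U n ∧
      e t p = some (Nat.bits n) ∧ enumCount r t n + 2 ^ ℓ n ≤ enumCount r T n := by
    intro n hn
    refine (hc n).resolve_left ?_
    rintro ⟨x, hxQ, rfl, hx⟩
    have := hno x hxQ hn
    simp only [hℓdef, hn] at hx
    omega
  have hs : c₁ + 8 ≤ Nat.log 2 L := hL.trans (Nat.log_le_self 2 _)
  have hgain := two_pow_logGain_mul_le (L := L) (by omega)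
  obtain ⟨a, ha⟩ : ∃ a, Nat.log 2 L * Nat.log 2 L = a := ⟨_, rfl⟩
  have has : (c₁ + 8) * Nat.log 2 L ≤ a := ha ▸ Nat.mul_le_mul_right _ hs
  have hai : ∀ i ≤ 2 ^ logGain L, i * (a + 2) + a ≤ L := fun i hi => by
    rw [ha] at hgain
    exact (Nat.add_le_add_right (Nat.mul_le_mul_right _ hi) _).trans hgain
  have hstage := exists_stage_candidates (ℓ := ℓ) (L := L) (I := 2 ^ logGain L) (k := k L)
    (m := m L) he hr ?_ ?_ ?_ ?_ _ le_rfl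
  -- A candidate at the last level has `2 ^ g * 2 ^ (n - g) = 2 ^ n` enumerated strings of its
  -- length, although `Q` contains one.
  · obtain ⟨t, ht⟩ := hstage
    obtain ⟨y, hy⟩ := List.exists_mem_of_length_pos ((Nat.two_pow_pos _).trans_le ht)
    obtain ⟨⟨u, rfl, rfl⟩, hcnt, -⟩ := mem_candidates.1 hy
    obtain ⟨x, hxQ, hx⟩ := hlen (binaryValue (u ++ [true]))
    have hlt := enumCount_lt_two_pow hr hx (not_not.2 hxQ) t
    have hle : logGain u.length ≤ binaryValue (u ++ [true]) := by
      have h1 := Nat.log_le_self 2 (binaryValue (u ++ [true]))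
      rw [log_two_binaryValue] at h1
      exact ((Nat.sub_le _ _).trans (Nat.log_le_self 2 _)).trans h1
    simp only [hℓdef, log_two_binaryValue] at hcnt
    rw [← pow_add, Nat.add_sub_cancel' hle] at hcnt
    omega
  · intro i hi hex
    have hiL : i ≤ L := by
      have := hai i hi.le
      have := Nat.le_mul_of_pos_right i (show 0 < a + 2 by omega)
      omega
    obtain ⟨t, ht, hy⟩ := hc₁ (Nat.pair L i) (by simpa using hex)
    simp only [Nat.unpair_pair] at ht hy
    refine ⟨t, ht, fun y hyl => (hy y hyl).trans ?_⟩
    have h1 := size_pair_le hiL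
    have h2 := hai i hi.le
    have h3 : 4 * Nat.log 2 L + 4 + c₁ ≤ (c₁ + 8) * Nat.log 2 L := by
      nlinarith
    simp only [hmdef, hkdef, ha]
    omega
  · intro u hu
    obtain ⟨p, t, T, h1, h2, h3⟩ := hcount (binaryValue (u ++ [true]))
      (by rw [log_two_binaryValue, hu])
    rw [natPrefixK, bits_binaryValue] at h1
    rw [bits_binaryValue] at h2
    exact ⟨p, t, T, h1, h2, h3⟩
  · simp only [hmdef, hkdef]
    omega
  · intro i hi
    have h2 := hai (i + 1) hi
    simp only [hmdef, hkdef, ha]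
    rw [add_mul, one_mul] at h2 ⊢
    omega

/-! ### Passage to real iterated logarithms -/

theorem mainTheorem5 (U : List Bool → List Bool →. List Bool) (hU : IsOptimalPrefixMachine U)
    (Q : Set (List Bool)) (hQ : IsCoEnumerable Q)
    (hlen : ∀ n : ℕ, ∃ x ∈ Q, x.length = n) :
    ∃ c : ℝ, {x : List Bool | x ∈ Q ∧
      (prefixK U x : ℝ) < (x.length : ℝ) + (natPrefixK U x.length : ℝ)
        - log2Iter 2 (x.length : ℝ) + c * log2Iter 3 (x.length : ℝ)}.Infinite := by
  obtain ⟨c, L₀, h⟩ := hU.exists_simple hQ hlen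
  -- Four units of `log2Iter 3` come from `logGain`; the fifth absorbs the additive constant and the
  -- rounding of `log2Iter 2`.
  refine ⟨5, fun hfin => ?_⟩
  obtain ⟨B, hB⟩ := (hfin.image List.length).bddAbove
  obtain ⟨v, hv⟩ : ∃ v, v = L₀ + c + B + 2 := ⟨_, rfl⟩
  -- For this `L` the iterated integer logarithms are exact: `Nat.log 2 L = 2 ^ v` and `Nat.log 2 (2
  -- ^ v) = v`. Letting `v` exceed `B` makes `x` longer than every string of the supposedly finite
  -- set.
  obtain ⟨x, hxQ, hxL, hx⟩ := h (2 ^ 2 ^ v) (by simp [Nat.log_pow]; omega)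
  have hbig : B < x.length := by
    have h1 : 2 ^ 2 ^ v ≤ x.length := hxL ▸ Nat.log_le_self 2 _
    have h2 : v < 2 ^ v := Nat.lt_two_pow_self
    have h3 : 2 ^ v < 2 ^ 2 ^ v := Nat.lt_two_pow_self
    omega
  refine absurd (hB ⟨x, ⟨hxQ, ?_⟩, rfl⟩) (not_le.2 hbig)
  have hn0 : x.length ≠ 0 := by omega
  have hn1 : 2 ^ 2 ^ 2 ^ v ≤ x.length := by
    have := Nat.pow_log_le_self 2 hn0
    rwa [hxL] at this
  have hn2 : x.length < 2 ^ (2 ^ 2 ^ v + 1) := by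
    have := Nat.lt_pow_succ_log_self one_lt_two x.length
    rwa [hxL] at this
  have hmono : ∀ {a b : ℝ}, 0 < a → a ≤ b → Real.logb 2 a ≤ Real.logb 2 b := fun ha hab =>
    Real.logb_le_logb_of_le one_lt_two ha hab
  have hpow : ∀ j : ℕ, Real.logb 2 ((2 : ℝ) ^ j) = j := fun j => by
    rw [Real.logb_pow, Real.logb_self_eq_one one_lt_two, mul_one]
  have l1 : ((2 : ℝ) ^ 2 ^ v) ≤ Real.logb 2 x.length := by
    have := hmono (a := (2 : ℝ) ^ 2 ^ 2 ^ v) (b := x.length) (by positivity) (by exact_mod_cast hn1)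
    rw [hpow] at this
    exact_mod_cast this
  have u1 : Real.logb 2 x.length ≤ (2 : ℝ) ^ (2 ^ v + 1) := by
    have := hmono (a := x.length) (b := (2 : ℝ) ^ (2 ^ 2 ^ v + 1)) (by positivity)
      (by exact_mod_cast hn2.le)
    rw [hpow] at this
    refine this.trans ?_
    push_cast
    rw [pow_succ]
    have : (1 : ℝ) ≤ 2 ^ 2 ^ v := one_le_pow₀ one_le_two
    linarith
  have hpos1 : (0 : ℝ) < Real.logb 2 x.length := lt_of_lt_of_le (by positivity) l1
  have l2 : (2 : ℝ) ^ v ≤ log2Iter 2 x.length := by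
    have := hmono (by positivity) l1
    rw [hpow] at this
    exact_mod_cast this
  have u2 : log2Iter 2 x.length ≤ (2 : ℝ) ^ v + 1 := by
    have := hmono hpos1 u1
    rw [hpow] at this
    exact_mod_cast this
  have l3 : (v : ℝ) ≤ log2Iter 3 x.length := by
    have := hmono (by positivity) l2
    rwa [hpow] at this
  have hgain : logGain (2 ^ 2 ^ v) = 2 ^ v - 4 * v := by simp [logGain, Nat.log_pow]
  have hxN : prefixK U x + 2 ^ v ≤ natPrefixK U x.length + x.length + 4 * v + c := by
    rw [hgain] at hx
    have h1 : 2 ^ v ≤ x.length := by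
      have h3 : 2 ^ v < 2 ^ 2 ^ v := Nat.lt_two_pow_self
      have h4 : 2 ^ 2 ^ v ≤ x.length := hxL ▸ Nat.log_le_self 2 _
      omega
    omega
  have hxR : (prefixK U x : ℝ) + 2 ^ v ≤ natPrefixK U x.length + x.length + 4 * v + c := by
    exact_mod_cast hxN
  have hvc : (c : ℝ) + 2 ≤ v := by
    rw [hv]
    exact_mod_cast (by omega : c + 2 ≤ L₀ + c + B + 2)
  linarith
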